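/- Let $L\ge 1$, let $d_0,\dots,d_L$ be natural numbers with $\min_{0\le i\le L} d_i\ge\min\{d_0,d_L\}$, let $\lambda>0$ and $\mathbf M^\natural\in\mathbb R^{d_L\times d_0}$. For $\mathbf w=(\mathbf W_1,\dots,\mathbf W_L)$ with $\mathbf W_i\in\mathbb R^{d_i\times d_{i-1}}$ put $$\mathcal L(\mathbf w)=\|\mathbf M^\natural-\mathbf W_L\mathbf W_{L-1}\cdots\mathbf W_1\|_F^2+\frac{\lambda}{L}\sum_{i=1}^L\|\mathbf W_i\|_F^2,$$ and for $\mathbf M\in\mathbb R^{d_L\times d_0}$ put $$\mathcal L_{\mathbf M^\natural}(\mathbf M)=\|\mathbf M^\natural-\mathbf M\|_F^2+\lambda\|\mathbf M\|_{\mathcal S^{2/L}}^{2/L},$$ where $\|\cdot\|_F$ is the Frobenius norm and, for $p>0$, $\|\mathbf M\|_{\mathcal S^p}=\bigl(\sum_{i=1}^{\min\{d_0,d_L\}}\sigma_i(\mathbf M)^p\bigr)^{1/p}$ is the Schatten-$p$ (quasi-)norm, with $\sigma_i(\mathbf M)$ the singular values of $\mathbf M$. Let $\Omega$ be the set of global minimizers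 of $\mathcal L$ over all $\mathbf w$, and $S$ the set of global minimizers of $\mathcal L_{\mathbf M^\natural}$ over $\mathbb R^{d_L\times d_0}$. Then for every $\mathbf w^*=(\mathbf W_1^*,\dots,\mathbf W_L^*)\in\Omega$ one has $\mathbf W_L^*\cdots\mathbf W_1^*\in S$; and for every $\mathbf M^*\in S$ there is $\mathbf w^*=(\mathbf W_1^*,\dots,\mathbf W_L^*)\in\Omega$ with $\mathbf W_L^*\cdots\mathbf W_1^*=\mathbf M^*$. -/

import Mathlib

open scoped Matrix.Norms.Frobenius

noncomputable section

/-- The set of global minimizers of a real-valued function. -/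
def argminSet {α : Type*} (f : α → ℝ) : Set α := {x | IsMinOn f Set.univ x}

/-- The `i`-th largest singular value (counted from `i = 0`) of a real matrix, as a linear map
between Euclidean spaces. -/
def matrixSingularValue {m n : ℕ} (X : Matrix (Fin m) (Fin n) ℝ) (i : ℕ) : ℝ :=
  (Matrix.toEuclideanLin X).singularValues i

/-- The Schatten-`p` norm (a quasi-norm for `0 < p < 1`), for `0 < p < ∞`: the `ℓ^p` (quasi-)norm of
the vector of the `min m n` singular values. -/
def schattenNorm {m n : ℕ} (p : ℝ) (X : Matrix (Fin m) (Fin n) ℝ) : ℝ :=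
  (∑ i ∈ Finset.range (min m n), matrixSingularValue X i ^ p) ^ (1 / p)

/-- The parameters of a depth-`L` factorization with layer widths `d 0, …, d L`; the factor of
index `i` (counted from `0`) has size `d (i + 1) × d i`. -/
abbrev Factors (d : ℕ → ℕ) (L : ℕ) : Type :=
  (i : Fin L) → Matrix (Fin (d (i + 1))) (Fin (d i)) ℝ

/-- The last factor, with its size written as `d (L + 1) × d L`. -/
def lastFactor {d : ℕ → ℕ} {L : ℕ} (W : Factors d (L + 1)) :
    Matrix (Fin (d (L + 1))) (Fin (d L)) ℝ :=
  W (Fin.last L)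

/-- The end-to-end product: last factor leftmost, first factor rightmost. -/
def endToEnd (d : ℕ → ℕ) : (L : ℕ) → Factors d L → Matrix (Fin (d L)) (Fin (d 0)) ℝ
  | 0, _ => 1
  | L + 1, W => lastFactor W * endToEnd d L (fun i => W i.castSucc)

/-- The `ℓ²`-regularized depth-`L` factorization loss; `‖·‖` is the Frobenius norm. -/
def factorizationLoss (d : ℕ → ℕ) (L : ℕ) (lam : ℝ) (Mnat : Matrix (Fin (d L)) (Fin (d 0)) ℝ)
    (W : Factors d L) : ℝ :=
  ‖Mnat - endToEnd d L W‖ ^ 2 + lam / (L : ℝ) * ∑ i : Fin L, ‖W i‖ ^ 2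

/-- The Schatten-`2/L` regularized loss; `‖·‖` is the Frobenius norm. -/
def schattenLoss {m n : ℕ} (L : ℕ) (lam : ℝ) (Mnat M : Matrix (Fin m) (Fin n) ℝ) : ℝ :=
  ‖Mnat - M‖ ^ 2 + lam * schattenNorm (2 / (L : ℝ)) M ^ (2 / (L : ℝ))

end

open scoped InnerProductSpace
open Module InnerProductSpace

/-! ### Gram-Schmidt and the Frobenius norm -/

/-! The regularizer `1/L * ∑ ‖W i‖²`, minimized over factorizations of a fixed `M`, equals the
Schatten term of `M`; both claims then follow formally. Lower bound (`schattenNorm_endToEnd_le`):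
push a right singular basis of the product through the layers, orthonormalizing after each one. Each
`W i` becomes triangular, so the `j`-th singular value is a product over `i` of absolute diagonal
coefficients `c i j`. AM-GM over `i` and Bessel over `j` conclude, with no singular value inequality
for products. Attainment (`exists_endToEnd_eq`): split an SVD into `L` balanced factors. -/

theorem Matrix.frobenius_norm_sq {m n : Type*} [Fintype m] [Fintype n] (A : Matrix m n ℝ) :
    ‖A‖ ^ 2 = ∑ i, ∑ j, A i j ^ 2 := by
  rw [Matrix.frobenius_norm_def, ← Real.sqrt_eq_rpow, Real.sq_sqrt (by positivity)]
  simp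

theorem Matrix.frobenius_norm_sq_eq_trace {m n : Type*} [Fintype m] [Fintype n]
    (A : Matrix m n ℝ) : ‖A‖ ^ 2 = (A * A.transpose).trace := by
  rw [Matrix.frobenius_norm_sq]
  simp [Matrix.trace, Matrix.mul_apply, sq]

theorem InnerProductSpace.norm_gramSchmidtNormed_le_one {E ι : Type*} [NormedAddCommGroup E]
    [InnerProductSpace ℝ E] [LinearOrder ι] [LocallyFiniteOrderBot ι] [WellFoundedLT ι]
    (x : ι → E) (j : ι) : ‖gramSchmidtNormed ℝ x j‖ ≤ 1 := by
  by_cases h : gramSchmidtNormed ℝ x j = 0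
  · simp [h]
  · exact (gramSchmidtNormed_unit_length' h).le

/-- The Gram-Schmidt norms of the image of a family under `T` are those of the family, scaled by the
diagonal coefficients of `T` in the two orthonormalized families. -/
theorem norm_gramSchmidt_map {E F ι : Type*} [NormedAddCommGroup E] [InnerProductSpace ℝ E]
    [NormedAddCommGroup F] [InnerProductSpace ℝ F] [LinearOrder ι] [LocallyFiniteOrderBot ι]
    [WellFoundedLT ι] (T : E →ₗ[ℝ] F) (x : ι → E) (j : ι) :
    ‖gramSchmidt ℝ (fun i => T (x i)) j‖ =
      |⟪gramSchmidtNormed ℝ (fun i => T (x i)) j, T (gramSchmidtNormed ℝ x j)⟫_ℝ| *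
        ‖gramSchmidt ℝ x j‖ := by
  set y : ι → F := fun i => T (x i) with hy
  -- Triangularity: `T` sends the span of the earlier `x i` into that of the earlier `y i`, which is
  -- orthogonal to `gramSchmidt ℝ y j`.
  have lower : ∀ z ∈ Submodule.span ℝ (x '' Set.Iio j), ⟪gramSchmidt ℝ y j, T z⟫_ℝ = 0 := by
    intro z hz
    induction hz using Submodule.span_induction with
    | mem z hz =>
      obtain ⟨i, hi, rfl⟩ := hz
      exact gramSchmidt_inv_triangular ℝ y hi
    | zero => simp
    | add a b _ _ ha hb => simp [inner_add_right, ha, hb]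
    | smul c a _ ha => simp [inner_smul_right, ha]
  have diag : x j - gramSchmidt ℝ x j ∈ Submodule.span ℝ (x '' Set.Iio j) := by
    rw [← span_gramSchmidt_Iio, sub_eq_of_eq_add' (gramSchmidt_def'' ℝ x j)]
    exact Submodule.sum_mem _ fun i hi => Submodule.smul_mem _ _ <|
      Submodule.subset_span ⟨i, Finset.mem_Iio.1 hi, rfl⟩
  have h1 : ⟪gramSchmidt ℝ y j, T (gramSchmidt ℝ x j)⟫_ℝ = ‖gramSchmidt ℝ y j‖ ^ 2 := by
    have h2 := lower _ diag
    rw [map_sub, inner_sub_right, sub_eq_zero] at h2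
    rw [← h2]
    change ⟪gramSchmidt ℝ y j, y j⟫_ℝ = _
    rw [gramSchmidt_def'' ℝ y j, inner_add_right, inner_sum, Finset.sum_eq_zero, add_zero,
      real_inner_self_eq_norm_sq]
    intro i hi
    rw [inner_smul_right, gramSchmidt_orthogonal ℝ y (Finset.mem_Iio.1 hi).ne', mul_zero]
  by_cases hx : gramSchmidt ℝ x j = 0
  · rw [hx, map_zero, inner_zero_right] at h1
    have : ‖gramSchmidt ℝ y j‖ = 0 := by nlinarith
    simp [this, hx]
  by_cases hy0 : gramSchmidt ℝ y j = 0
  · simp [hy0, gramSchmidtNormed]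
  · have hx' := norm_ne_zero_iff.2 hx
    have hy' := norm_ne_zero_iff.2 hy0
    simp only [gramSchmidtNormed, map_smul, inner_smul_left, inner_smul_right, h1]
    simp only [RCLike.ofReal_real_eq_id, id_eq, map_inv₀, conj_trivial, abs_mul, abs_inv, abs_norm,
      abs_pow]
    field_simp

/-- Bessel's inequality for the Frobenius norm. -/
theorem sum_norm_sq_gramSchmidtNormed_le {m n k : ℕ} (W : Matrix (Fin m) (Fin n) ℝ)
    (x : Fin k → EuclideanSpace ℝ (Fin n)) :
    ∑ j, ‖Matrix.toEuclideanLin W (gramSchmidtNormed ℝ x j)‖ ^ 2 ≤ ‖W‖ ^ 2 := by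
  have entry : ∀ (i : Fin m) (z : EuclideanSpace ℝ (Fin n)),
      Matrix.toEuclideanLin W z i = ⟪z, WithLp.toLp 2 (W i)⟫_ℝ := by
    intro i z
    simp [Matrix.mulVec, dotProduct, PiLp.inner_apply]
  simp only [EuclideanSpace.norm_sq_eq, entry]
  rw [Finset.sum_comm, Matrix.frobenius_norm_sq]
  refine Finset.sum_le_sum fun i _ => ?_
  -- Degenerate vectors normalize to `0`, so only the nonzero ones are orthonormal; the others
  -- contribute nothing to the sum.
  have hb := (gramSchmidtNormed_orthonormal' (𝕜 := ℝ) x).sum_inner_products_le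
    (WithLp.toLp 2 (W i)) (s := Finset.univ)
  rw [EuclideanSpace.norm_sq_eq] at hb
  simp only [Real.norm_eq_abs, sq_abs] at hb ⊢
  refine le_trans (le_of_eq ?_) hb
  refine (Finset.sum_filter_of_ne (p := fun j => gramSchmidtNormed ℝ x j ≠ 0)
    fun j _ hj h => hj ?_).symm.trans (Finset.sum_subtype _ (by simp) _)
  simp [h]

/-- Iterates `norm_gramSchmidt_map`: `c i j` is the absolute diagonal coefficient of `W i` between
the orthonormalized images before and after layer `i`. -/
theorem exists_gramSchmidt_factors (d : ℕ → ℕ) {k : ℕ} (x : Fin k → EuclideanSpace ℝ (Fin (d 0)))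
    (L : ℕ) (W : Factors d L) :
    ∃ c : Fin L → Fin k → ℝ, (∀ i j, 0 ≤ c i j) ∧ (∀ i, ∑ j, c i j ^ 2 ≤ ‖W i‖ ^ 2) ∧
      ∀ j, ‖gramSchmidt ℝ (fun l => Matrix.toEuclideanLin (endToEnd d L W) (x l)) j‖ =
        (∏ i, c i j) * ‖gramSchmidt ℝ x j‖ := by
  induction L with
  | zero => exact ⟨fun i => i.elim0, fun i => i.elim0, fun i => i.elim0, by simp [endToEnd]⟩
  | succ L ih =>
    obtain ⟨c, hc0, hc, hprod⟩ := ih fun i => W i.castSucc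
    set y := fun l => Matrix.toEuclideanLin (endToEnd d L fun i => W i.castSucc) (x l) with hy
    set T := Matrix.toEuclideanLin (lastFactor W) with hT
    have hTy : (fun l => Matrix.toEuclideanLin (endToEnd d (L + 1) W) (x l)) =
        fun l => T (y l) := by
      funext l
      simp [hT, hy, endToEnd]
    refine ⟨Fin.snoc (α := fun _ => Fin k → ℝ) c fun j =>
      |⟪gramSchmidtNormed ℝ (fun i => T (y i)) j, T (gramSchmidtNormed ℝ y j)⟫_ℝ|, ?_, ?_, ?_⟩
    · intro i
      induction i using Fin.lastCases with
      | last => simp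
      | cast i => simpa using hc0 i
    · intro i
      induction i using Fin.lastCases with
      | last =>
        refine le_trans ?_ (sum_norm_sq_gramSchmidtNormed_le (lastFactor W) y)
        refine Finset.sum_le_sum fun j _ => ?_
        rw [Fin.snoc_last]
        refine pow_le_pow_left₀ (abs_nonneg _) ((abs_real_inner_le_norm _ _).trans ?_) 2
        exact mul_le_of_le_one_left (norm_nonneg _) (norm_gramSchmidtNormed_le_one _ _)
      | cast i => simpa using hc i
    · intro j
      rw [hTy, norm_gramSchmidt_map, hprod, Fin.prod_univ_castSucc]
      simp only [Fin.snoc_castSucc, Fin.snoc_last]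
      ring

/-! ### Singular value decomposition -/

theorem exists_rightSingularBasis {m n : ℕ} (M : Matrix (Fin m) (Fin n) ℝ) :
    ∃ v : OrthonormalBasis (Fin n) ℝ (EuclideanSpace ℝ (Fin n)), ∀ i j,
      ⟪Matrix.toEuclideanLin M (v i), Matrix.toEuclideanLin M (v j)⟫_ℝ =
        if i = j then matrixSingularValue M i ^ 2 else 0 := by
  set T := Matrix.toEuclideanLin M
  have hn : finrank ℝ (EuclideanSpace ℝ (Fin n)) = n := by simp
  refine ⟨T.isSymmetric_adjoint_comp_self.eigenvectorBasis hn, fun i j => ?_⟩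
  rw [← LinearMap.adjoint_inner_right, ← LinearMap.comp_apply,
    LinearMap.IsSymmetric.apply_eigenvectorBasis, inner_smul_right,
    orthonormal_iff_ite.1 (OrthonormalBasis.orthonormal _)]
  split_ifs with h
  · subst h
    rw [matrixSingularValue, T.sq_singularValues_fin hn]
    simp
  · simp

theorem matrixSingularValue_nonneg {m n : ℕ} (M : Matrix (Fin m) (Fin n) ℝ) (i : ℕ) :
    0 ≤ matrixSingularValue M i :=
  LinearMap.singularValues_nonneg _ _

theorem matrixSingularValue_eq_zero {m n : ℕ} (M : Matrix (Fin m) (Fin n) ℝ) {i : ℕ}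
    (hi : min m n ≤ i) : matrixSingularValue M i = 0 := by
  refine (LinearMap.singularValues_eq_zero_iff_le_finrank_range _).2 (le_trans (le_min ?_ ?_) hi)
  · simpa using Submodule.finrank_le (LinearMap.range (Matrix.toEuclideanLin M))
  · simpa using LinearMap.finrank_range_le (Matrix.toEuclideanLin M)

/-- The matrix with columns `b 0, …, b (k - 1)`. -/
def columnMatrix {n k : ℕ} (h : k ≤ n) (b : Fin n → EuclideanSpace ℝ (Fin n)) :
    Matrix (Fin n) (Fin k) ℝ :=
  Matrix.of fun i j => b (Fin.castLE h j) i

theorem columnMatrix_transpose_mul_self {n k : ℕ} (h : k ≤ n)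
    (b : OrthonormalBasis (Fin n) ℝ (EuclideanSpace ℝ (Fin n))) :
    (columnMatrix h b).transpose * columnMatrix h b = 1 := by
  ext i j
  have := orthonormal_iff_ite.1 b.orthonormal (Fin.castLE h i) (Fin.castLE h j)
  simp only [PiLp.inner_apply, (Fin.castLE_injective h).eq_iff] at this
  simp only [columnMatrix, Matrix.mul_apply, Matrix.transpose_apply, Matrix.of_apply,
    Matrix.one_apply, ← this]
  simp [mul_comm]

theorem exists_svd {m n : ℕ} (M : Matrix (Fin m) (Fin n) ℝ) {k : ℕ} (hk : k = min m n) :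
    ∃ (A : Matrix (Fin m) (Fin k) ℝ) (B : Matrix (Fin n) (Fin k) ℝ),
      A.transpose * A = 1 ∧ B.transpose * B = 1 ∧
      M = A * Matrix.diagonal (fun j : Fin k => matrixSingularValue M j) * B.transpose := by
  obtain ⟨v, hv⟩ := exists_rightSingularBasis M
  have hkm : k ≤ m := hk ▸ min_le_left _ _
  have hkn : k ≤ n := hk ▸ min_le_right _ _
  have hnorm : ∀ i, ‖Matrix.toEuclideanLin M (v i)‖ = matrixSingularValue M i := by
    intro i
    have := hv i i
    rw [if_pos rfl, real_inner_self_eq_norm_sq] at this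
    exact (sq_eq_sq₀ (norm_nonneg _) (matrixSingularValue_nonneg _ _)).1 this
  -- Left singular vectors, orthonormal on `s`, where the singular value is nonzero; values off `s`
  -- are irrelevant, since the extension `b` agrees with `u` only on `s`.
  let u : Fin m → EuclideanSpace ℝ (Fin m) := fun j =>
    if h : (j : ℕ) < n then (matrixSingularValue M j)⁻¹ • Matrix.toEuclideanLin M (v ⟨j, h⟩) else 0
  let s : Set (Fin m) := {j | matrixSingularValue M j ≠ 0}
  have hsn : ∀ j ∈ s, (j : ℕ) < n := fun j hj => by
    by_contra h
    exact hj (matrixSingularValue_eq_zero M ((min_le_right _ _).trans (not_lt.1 h)))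
  have hu : Orthonormal ℝ (s.domRestrict u) := by
    rw [orthonormal_iff_ite]
    rintro ⟨i, hi⟩ ⟨j, hj⟩
    have hi' : matrixSingularValue M i ≠ 0 := hi
    simp only [Set.domRestrict_apply, u, hsn i hi, hsn j hj, dif_pos, inner_smul_left,
      inner_smul_right, hv, Subtype.mk.injEq, Fin.ext_iff]
    split_ifs with h
    · rw [← h]
      simp only [map_inv₀, conj_trivial]
      field_simp
    · simp
  obtain ⟨b, hb⟩ := hu.exists_orthonormalBasis_extension_of_card_eq (by simp)
  refine ⟨columnMatrix hkm b, columnMatrix hkn v, columnMatrix_transpose_mul_self _ _,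
    columnMatrix_transpose_mul_self _ _, ?_⟩
  apply Matrix.toEuclideanLin.injective
  refine v.toBasis.ext fun j => ?_
  have hB : (columnMatrix hkn v).transpose.mulVec (v j) =
      fun i => if Fin.castLE hkn i = j then 1 else 0 := by
    funext i
    rw [← orthonormal_iff_ite.1 v.orthonormal]
    simp [columnMatrix, Matrix.mulVec, dotProduct, PiLp.inner_apply, mul_comm]
  have hR : Matrix.toEuclideanLin (columnMatrix hkm b *
      Matrix.diagonal (fun j : Fin k => matrixSingularValue M j) * (columnMatrix hkn v).transpose)
      (v j) = ∑ i : Fin k, if Fin.castLE hkn i = j then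
        matrixSingularValue M i • b (Fin.castLE hkm i) else 0 := by
    ext l
    rw [Matrix.toLpLin_apply, ← Matrix.mulVec_mulVec, hB, ← Matrix.mulVec_mulVec,
      show (Matrix.diagonal fun j : Fin k => matrixSingularValue M j).mulVec _ = _ from
        funext (Matrix.mulVec_diagonal _ _)]
    simp [columnMatrix, Matrix.mulVec, dotProduct, WithLp.ofLp_sum,
      apply_ite (fun z : EuclideanSpace ℝ (Fin m) => z l), mul_comm]
  rw [OrthonormalBasis.coe_toBasis, hR]
  by_cases hj : (j : ℕ) < k
  · rw [Finset.sum_eq_single ⟨j, hj⟩ (fun i _ hi => if_neg fun h => hi (by simp [← h])) (by simp),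
      if_pos (by simp)]
    by_cases h0 : matrixSingularValue M j = 0
    · simpa [h0] using hnorm j
    · rw [hb _ (by simpa [s] using h0)]
      simp [u, h0]
  · rw [Finset.sum_eq_zero fun i _ => if_neg fun h => hj (by simp [← h]), ← norm_eq_zero, hnorm]
    exact matrixSingularValue_eq_zero M (hk ▸ not_lt.1 hj)

/-! ### The two inequalities between the regularizers -/

theorem schattenNorm_rpow {m n : ℕ} {p : ℝ} (hp : p ≠ 0) (M : Matrix (Fin m) (Fin n) ℝ) :
    schattenNorm p M ^ p = ∑ i ∈ Finset.range (min m n), matrixSingularValue M i ^ p := by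
  rw [schattenNorm, ← Real.rpow_mul, one_div_mul_cancel hp, Real.rpow_one]
  exact Finset.sum_nonneg fun i _ => Real.rpow_nonneg (matrixSingularValue_nonneg _ _) _

theorem rpow_prod_le_sum_sq {L : ℕ} (hL : 1 ≤ L) (c : Fin L → ℝ) (hc : ∀ i, 0 ≤ c i) :
    (∏ i, c i) ^ (2 / (L : ℝ)) ≤ 1 / (L : ℝ) * ∑ i, c i ^ 2 := by
  have hL' : (L : ℝ) ≠ 0 := by positivity
  have h := Real.geom_mean_le_arith_mean_weighted Finset.univ (fun _ : Fin L => 1 / (L : ℝ))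
    (fun i => c i ^ 2) (fun _ _ => by positivity) (by simp [hL']) (fun _ _ => by positivity)
  rw [← Finset.mul_sum] at h
  refine le_trans (le_of_eq ?_) h
  rw [← Real.finsetProd_rpow _ _ fun i _ => hc i]
  refine Finset.prod_congr rfl fun i _ => ?_
  rw [← Real.rpow_natCast, ← Real.rpow_mul (hc i)]
  congr 1
  push_cast
  ring

theorem schattenNorm_endToEnd_le {L : ℕ} (hL : 1 ≤ L) (d : ℕ → ℕ) (W : Factors d L) :
    schattenNorm (2 / (L : ℝ)) (endToEnd d L W) ^ (2 / (L : ℝ)) ≤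
      1 / (L : ℝ) * ∑ i, ‖W i‖ ^ 2 := by
  have hp : 2 / (L : ℝ) ≠ 0 := by positivity
  set M := endToEnd d L W with hM
  obtain ⟨v, hv⟩ := exists_rightSingularBasis M
  obtain ⟨c, hc0, hc, hprod⟩ := exists_gramSchmidt_factors d v L W
  have hσ : ∀ j : Fin (d 0), matrixSingularValue M j = ∏ i, c i j := by
    intro j
    have h := hprod j
    -- Both `v` and its image under `M` are already orthogonal, so Gram-Schmidt leaves them
    -- unchanged.
    rw [gramSchmidt_of_orthogonal ℝ (fun i j hij => by
        simpa [hij] using hv i j),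
      gramSchmidt_of_orthogonal ℝ (fun i j hij => v.orthonormal.2 hij), v.norm_eq_one,
      mul_one] at h
    rw [← h]
    refine (sq_eq_sq₀ (matrixSingularValue_nonneg _ _) (norm_nonneg _)).1 ?_
    rw [← real_inner_self_eq_norm_sq, hv, if_pos rfl]
  rw [schattenNorm_rpow hp]
  calc ∑ i ∈ Finset.range (min (d L) (d 0)), matrixSingularValue M i ^ (2 / (L : ℝ))
      ≤ ∑ i ∈ Finset.range (d 0), matrixSingularValue M i ^ (2 / (L : ℝ)) :=
        Finset.sum_le_sum_of_subset_of_nonneg (by simp)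
          fun i _ _ => Real.rpow_nonneg (matrixSingularValue_nonneg _ _) _
    _ = ∑ j : Fin (d 0), (∏ i, c i j) ^ (2 / (L : ℝ)) := by
        rw [Finset.sum_range]
        simp [hσ]
    _ ≤ ∑ j : Fin (d 0), 1 / (L : ℝ) * ∑ i, c i j ^ 2 :=
        Finset.sum_le_sum fun j _ => rpow_prod_le_sum_sq hL _ fun i => hc0 i j
    _ = 1 / (L : ℝ) * ∑ i, ∑ j, c i j ^ 2 := by
        rw [← Finset.mul_sum, Finset.sum_comm]
    _ ≤ 1 / (L : ℝ) * ∑ i, ‖W i‖ ^ 2 := by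
        gcongr with i
        exact hc i

/-- The inner `(A i).transpose * A i` telescope. The factor `(A L).transpose` lets the induction
start at `L = 0`, where the product is `1`, not `A 0 * (A 0).transpose`. -/
theorem transpose_mul_endToEnd (d : ℕ → ℕ) {k : ℕ} (A : (i : ℕ) → Matrix (Fin (d i)) (Fin k) ℝ)
    (D : Matrix (Fin k) (Fin k) ℝ) (L : ℕ) (hA : ∀ i ≤ L, (A i).transpose * A i = 1) :
    (A L).transpose * endToEnd d L (fun i => A (i + 1) * D * (A i).transpose) =
      D ^ L * (A 0).transpose := by
  induction L with
  | zero => simp [endToEnd]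
  | succ L ih =>
    have h1 := ih fun i hi => hA i (by omega)
    have h2 := hA (L + 1) le_rfl
    simp only [endToEnd, lastFactor, Fin.val_castSucc, Fin.val_last]
    simp only [Matrix.mul_assoc] at h1 ⊢
    rw [h1, ← Matrix.mul_assoc, h2, Matrix.one_mul, pow_succ', Matrix.mul_assoc]

theorem norm_sq_mul_diagonal_mul_transpose {m n k : ℕ} {A : Matrix (Fin m) (Fin k) ℝ}
    {B : Matrix (Fin n) (Fin k) ℝ} (hA : A.transpose * A = 1) (hB : B.transpose * B = 1)
    (t : Fin k → ℝ) : ‖A * Matrix.diagonal t * B.transpose‖ ^ 2 = ∑ j, t j ^ 2 := by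
  rw [Matrix.frobenius_norm_sq_eq_trace]
  have : A * Matrix.diagonal t * B.transpose * (A * Matrix.diagonal t * B.transpose).transpose =
      A * (Matrix.diagonal t * (B.transpose * B) * Matrix.diagonal t * A.transpose) := by
    simp only [Matrix.transpose_mul, Matrix.transpose_transpose, Matrix.diagonal_transpose,
      Matrix.mul_assoc]
  rw [this, Matrix.trace_mul_comm, hB, Matrix.mul_one, Matrix.mul_assoc, hA, Matrix.mul_one,
    Matrix.diagonal_mul_diagonal, Matrix.trace_diagonal]
  simp only [sq]

/-- Each factor carries the singular values to the power `1/L`, framed by matrices with orthonormal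
columns, so all factors have equal norm. -/
theorem exists_endToEnd_eq {L : ℕ} (hL : 1 ≤ L) (d : ℕ → ℕ)
    (hd : ∀ i ≤ L, min (d 0) (d L) ≤ d i) (M : Matrix (Fin (d L)) (Fin (d 0)) ℝ) :
    ∃ W : Factors d L, endToEnd d L W = M ∧
      1 / (L : ℝ) * ∑ i, ‖W i‖ ^ 2 = schattenNorm (2 / (L : ℝ)) M ^ (2 / (L : ℝ)) := by
  have hp : 2 / (L : ℝ) ≠ 0 := by positivity
  have hL0 : (L : ℝ) ≠ 0 := by positivity
  obtain ⟨P, hP⟩ : ∃ P, P = min (d L) (d 0) := ⟨_, rfl⟩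
  obtain ⟨U, V, hU, hV, hM⟩ := exists_svd M hP
  -- The width hypothesis enters here: `P` orthonormal columns must fit in every layer.
  have hiso : ∀ i, ∃ A : Matrix (Fin (d i)) (Fin P) ℝ, i ≤ L → A.transpose * A = 1 := by
    intro i
    by_cases hi : i ≤ L
    · have h : P ≤ d i := by have := hd i hi; omega
      exact ⟨columnMatrix h (EuclideanSpace.basisFun (Fin (d i)) ℝ),
        fun _ => columnMatrix_transpose_mul_self h _⟩
    · exact ⟨0, fun h => absurd h hi⟩
  choose A₁ hA₁ using hiso
  obtain ⟨A, hA0, hAL, hA⟩ : ∃ A : (i : ℕ) → Matrix (Fin (d i)) (Fin P) ℝ, A 0 = V ∧ A L = U ∧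
      ∀ i ≤ L, (A i).transpose * A i = 1 := by
    refine ⟨Function.update (Function.update A₁ 0 V) L U, ?_, by simp, fun i hi => ?_⟩
    · rw [Function.update_of_ne (by omega), Function.update_self]
    · by_cases h : i = L
      · subst h
        simpa using hU
      · by_cases h0 : i = 0
        · subst h0
          rw [Function.update_of_ne h]
          simpa using hV
        · rw [Function.update_of_ne h, Function.update_of_ne h0]
          exact hA₁ i hi
  let t : Fin P → ℝ := fun j => matrixSingularValue M j ^ (1 / (L : ℝ))
  have htL : ∀ j, t j ^ L = matrixSingularValue M j := fun j => by
    rw [← Real.rpow_natCast, ← Real.rpow_mul (matrixSingularValue_nonneg _ _),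
      one_div_mul_cancel hL0, Real.rpow_one]
  have ht2 : ∀ j, t j ^ 2 = matrixSingularValue M j ^ (2 / (L : ℝ)) := fun j => by
    rw [← Real.rpow_natCast, ← Real.rpow_mul (matrixSingularValue_nonneg _ _)]
    congr 1
    push_cast
    ring
  refine ⟨fun i => A (i + 1) * Matrix.diagonal t * (A i).transpose, ?_, ?_⟩
  · obtain ⟨K, rfl⟩ : ∃ K, L = K + 1 := ⟨L - 1, by omega⟩
    have h := transpose_mul_endToEnd d A (Matrix.diagonal t) K fun i hi => hA i (by omega)
    simp only [endToEnd, lastFactor, Fin.val_castSucc, Fin.val_last]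
    rw [Matrix.mul_assoc, h, ← Matrix.mul_assoc, Matrix.mul_assoc (A (K + 1)), ← pow_succ',
      Matrix.diagonal_pow, hAL, hA0]
    conv_rhs => rw [hM]
    congr 3
    funext j
    exact htL j
  · have hn : ∀ i : Fin L, ‖A (i + 1) * Matrix.diagonal t * (A i).transpose‖ ^ 2 =
        ∑ j, t j ^ 2 := fun i =>
      norm_sq_mul_diagonal_mul_transpose (hA _ (by omega)) (hA _ (by omega)) t
    rw [Finset.sum_congr rfl fun i _ => hn i, schattenNorm_rpow hp, ← hP, Finset.sum_range]
    simp [ht2, hL0]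

theorem factorizationLoss_eq (d : ℕ → ℕ) (L : ℕ) (lam : ℝ)
    (Mnat : Matrix (Fin (d L)) (Fin (d 0)) ℝ) (W : Factors d L) :
    factorizationLoss d L lam Mnat W =
      ‖Mnat - endToEnd d L W‖ ^ 2 + lam * (1 / (L : ℝ) * ∑ i, ‖W i‖ ^ 2) := by
  rw [factorizationLoss]
  ring

theorem mainTheorem7 (L : ℕ) (hL : 1 ≤ L) (d : ℕ → ℕ)
    (hd : ∀ i ≤ L, min (d 0) (d L) ≤ d i)
    (lam : ℝ) (hlam : 0 < lam) (Mnat : Matrix (Fin (d L)) (Fin (d 0)) ℝ) :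
    (∀ W ∈ argminSet (factorizationLoss d L lam Mnat),
      endToEnd d L W ∈ argminSet (schattenLoss L lam Mnat)) ∧
    (∀ M ∈ argminSet (schattenLoss L lam Mnat),
      ∃ W ∈ argminSet (factorizationLoss d L lam Mnat), endToEnd d L W = M) := by
  have lower : ∀ W, schattenLoss L lam Mnat (endToEnd d L W) ≤ factorizationLoss d L lam Mnat W := by
    intro W
    rw [factorizationLoss_eq, schattenLoss]
    gcongr
    exact schattenNorm_endToEnd_le hL d W
  have attained : ∀ M, ∃ W, endToEnd d L W = M ∧
      factorizationLoss d L lam Mnat W = schattenLoss L lam Mnat M := by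
    intro M
    obtain ⟨W, hW, hn⟩ := exists_endToEnd_eq hL d hd M
    exact ⟨W, hW, by rw [factorizationLoss_eq, schattenLoss, hn, hW]⟩
  constructor
  · intro W hW M _
    obtain ⟨W', -, h⟩ := attained M
    exact (lower W).trans ((hW (Set.mem_univ W')).trans h.le)
  · intro M hM
    obtain ⟨W, hW, h⟩ := attained M
    exact ⟨W, fun W' _ => h.le.trans ((hM (Set.mem_univ _)).trans (lower W')), hW⟩
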